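/- **Theorem 1.1.** For integers $n\ge 0$ and $k$ let $\binom{n}{k}_2$ be the trinomial coefficient defined by $(1+x+x^{-1})^n=\sum_{k=-n}^{n}\binom{n}{k}_2x^k$. Let $(S_n)_{n\ge 0}$ be given by $S_0=0$, $S_1=1$, $S_{n+1}=4S_n-S_{n-1}$ for $n\ge 1$, and let $\left(\frac{a}{p}\right)$ denote the Legendre symbol. Let $p>3$ be a prime and let $d$ be an integer with $0\le d\le p-1$. Congruences modulo $p$ between rational numbers assert that both sides have denominator prime to $p$ and that their difference is $p$ times a rational number with denominator prime to $p$. If $d$ is odd, then $p$ divides $\sum_{k=0}^{p-1}\binom{k}{d}_2$, and $$\frac1p\sum_{k=0}^{p-1}\binom{k}{d}_2\equiv\frac{(-1)^{\frac{d+1}2}}{2}\Bigg(\sum_{k=1}^{(d-1)/2}\frac{(-1)^k}{k}-3\sum_{\substack{1\le k\le (d-1)/2\\ 3\mid k+p}}\frac{(-1)^k}{k}\Bigg)\pmod p.$$ If $d$ is even, then $p$ divides both $(-1)^{\frac d2}\sum_{k=0}^{p-1}\binom{k}{d}_2-(-1)^{\frac{p-1}2}$ and $S_{\left(p-\left(\frac{3}{p}\right)\right)/2}$,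 and $$\frac1p\Bigg((-1)^{\frac d2}\sum_{k=0}^{p-1}\binom{k}{d}_2-(-1)^{\frac{p-1}2}\Bigg)\equiv 3\left(\frac{-2}{p}\right)\frac{S_{\left(p-\left(\frac{3}{p}\right)\right)/2}}{p}-2\sum_{0\le j<d/2}\frac{(-1)^j}{2j+1}+3\sum_{\substack{0\le j<d/2\\ 3\nmid p-2j-1}}\frac{(-1)^j}{2j+1}\pmod p.$$ -/

import Mathlib

/-- The trinomial coefficient `binom(n, k)_2`: the coefficient of `x ^ k` in the Laurent
polynomial `(1 + x + x⁻¹) ^ n` with integer coefficients, for `n : ℕ` and `k : ℤ`. -/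
noncomputable def trinomialCoeff (n : ℕ) (k : ℤ) : ℤ :=
  ((1 + LaurentPolynomial.T 1 + LaurentPolynomial.T (-1) : LaurentPolynomial ℤ) ^ n).coeff k

/-- The sequence `S 0 = 0`, `S 1 = 1`, `S (n + 1) = 4 * S n - S (n - 1)` for `n ≥ 1`. -/
def lucasS : ℕ → ℤ
  | 0 => 0
  | 1 => 1
  | n + 2 => 4 * lucasS (n + 1) - lucasS n

/-- The congruence `a ≡ b (mod p)` between rational numbers, for a prime `p`: both are
`p`-integral (the reduced denominator is prime to `p`), and `a - b = p * c` for some `p`-integral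
rational `c`. -/
def RatModEq (p : ℕ) (a b : ℚ) : Prop :=
  ¬ p ∣ a.den ∧ ¬ p ∣ b.den ∧ ∃ c : ℚ, ¬ p ∣ c.den ∧ a - b = (p : ℚ) * c

/-! ### Trinomial coefficients -/

/-! Write `T(n, k)` for the trinomial coefficient and `A(k)` for its sum over `n < p`. Summing the
recurrence telescopes to `A(k - 1) + A(k + 1) = T(p, k) - [k = 0]`, so `A` is known along each
parity class from one starting value and the `T(p, k)` modulo `p ^ 2`. For `0 < k < p`, `T(p, k) / p
≡ (ω ^ (p - k) + ω ^ (k - p)) / k` with `ω` a primitive cube root of unity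
(`mul_trinomialCoeff_modEq`); these terms form the harmonic sums. Odd start: by symmetry `2 * A(1) =
T(p, 0) - 1`, which vanishes modulo `p ^ 2` (`central_trinomialCoeff_modEq`). Even start: `A(p - 1)
= 1` gives `A(0)` as an alternating sum of `T(p, k)` over odd `k < p`. There `T(p, k)` may be
replaced by `choose p k` times the trace of `ω ^ (p - k)`, giving the part odd in `i` of powers `(ω
± i) ^ p`. As `(ω + i) ^ 2 = ω * i * (2 + √3)`, the sum is a combination of Lucas numbers
(`twistedChooseSum_eq`), and Frobenius in `ℤ[√3]` together with the norm equation evaluates it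
modulo `p ^ 2` (`twistedChooseSum_modEq`). -/

open LaurentPolynomial in
theorem trinomialCoeff_zero (k : ℤ) : trinomialCoeff 0 k = if k = 0 then 1 else 0 := by
  rw [trinomialCoeff, pow_zero, ← T_zero, T_apply]
  simp [eq_comm]

open LaurentPolynomial in
theorem trinomialCoeff_succ (n : ℕ) (k : ℤ) :
    trinomialCoeff (n + 1) k =
      trinomialCoeff n (k - 1) + trinomialCoeff n k + trinomialCoeff n (k + 1) := by
  have h (f : LaurentPolynomial ℤ) (m : ℤ) : (f * T m).coeff k = f.coeff (k - m) := by
    have := AddMonoidAlgebra.coeff_mul_single_add f (1 : ℤ) m (k - m)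
    rwa [sub_add_cancel, mul_one] at this
  rw [trinomialCoeff, pow_succ, mul_add, mul_add, mul_one]
  simp only [AddMonoidAlgebra.coeff_add, Finsupp.add_apply, h]
  simp only [trinomialCoeff, sub_neg_eq_add]
  ring

theorem trinomialCoeff_neg (n : ℕ) (k : ℤ) : trinomialCoeff n (-k) = trinomialCoeff n k := by
  induction n generalizing k with
  | zero => simp [trinomialCoeff_zero]
  | succ n ih =>
    rw [trinomialCoeff_succ, trinomialCoeff_succ, ih, show -k - 1 = -(k + 1) by ring,
      show -k + 1 = -(k - 1) by ring, ih, ih]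
    ring

theorem trinomialCoeff_eq_zero (n : ℕ) (k : ℤ) (h : (n : ℤ) < |k|) : trinomialCoeff n k = 0 := by
  induction n generalizing k with
  | zero =>
    rw [trinomialCoeff_zero, if_neg]
    rintro rfl
    simp at h
  | succ n ih =>
    push_cast at h
    rw [trinomialCoeff_succ, ih, ih, ih] <;> grind

theorem trinomialCoeff_self (n : ℕ) : trinomialCoeff n n = 1 := by
  induction n with
  | zero => simp [trinomialCoeff_zero]
  | succ n ih =>
    rw [trinomialCoeff_succ, trinomialCoeff_eq_zero n (n + 1 : ℕ) (by grind),
      trinomialCoeff_eq_zero n ((n + 1 : ℕ) + 1) (by grind)]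
    simpa using ih

/-- This is `x * d/dx` applied to `(1 + x + x⁻¹) ^ (n + 1)`, read off coefficientwise. -/
theorem mul_trinomialCoeff_succ (n : ℕ) (k : ℤ) :
    k * trinomialCoeff (n + 1) k =
      (n + 1) * (trinomialCoeff n (k - 1) - trinomialCoeff n (k + 1)) := by
  induction n generalizing k with
  | zero =>
    rw [trinomialCoeff_succ]
    simp only [trinomialCoeff_zero]
    split_ifs <;> grind
  | succ n ih =>
    have h1 := ih k
    have h2 := ih (k - 1)
    have h3 := ih (k + 1)
    have h4 := trinomialCoeff_succ n (k - 1)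
    have h5 := trinomialCoeff_succ n (k + 1)
    rw [trinomialCoeff_succ (n + 1) k]
    rw [show k - 1 + 1 = k by ring] at *
    rw [show k + 1 - 1 = k by ring] at *
    push_cast
    linear_combination h1 + h2 + h3 - (n + 1) * h4 + (n + 1) * h5

theorem coeff_one_add_X_add_X_sq_pow (n e : ℕ) :
    ((1 + Polynomial.X + Polynomial.X ^ 2 : Polynomial ℤ) ^ n).coeff e =
      trinomialCoeff n ((e : ℤ) - n) := by
  induction n generalizing e with
  | zero => simp [trinomialCoeff_zero, Polynomial.coeff_one]
  | succ n ih =>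
    rw [pow_succ, mul_add, mul_add, mul_one, trinomialCoeff_succ]
    match e with
    | 0 =>
      rw [trinomialCoeff_eq_zero n _ (by grind), trinomialCoeff_eq_zero n _ (by grind)]
      simp [Polynomial.mul_coeff_zero, ih]
    | 1 =>
      rw [trinomialCoeff_eq_zero n _ (by grind)]
      simp [Polynomial.coeff_mul_X_pow', ih]
      ring_nf
    | e + 2 =>
      simp only [Polynomial.coeff_add, Polynomial.coeff_mul_X, Polynomial.coeff_mul_X_pow, ih]
      push_cast
      ring_nf

theorem sum_range_trinomialCoeff_add (N : ℕ) (k : ℤ) :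
    ∑ n ∈ Finset.range N, trinomialCoeff n (k - 1) + ∑ n ∈ Finset.range N, trinomialCoeff n (k + 1)
      = trinomialCoeff N k - if k = 0 then 1 else 0 := by
  rw [← trinomialCoeff_zero, ← Finset.sum_range_sub (fun n => trinomialCoeff n k) N,
    ← Finset.sum_add_distrib]
  refine Finset.sum_congr rfl fun n _ => ?_
  rw [trinomialCoeff_succ]
  ring

theorem sum_range_trinomialCoeff_add_two (p k : ℕ) :
    ∑ n ∈ Finset.range p, trinomialCoeff n (k + 2 : ℕ) =
      trinomialCoeff p (k + 1 : ℕ) - ∑ n ∈ Finset.range p, trinomialCoeff n k := by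
  have h := sum_range_trinomialCoeff_add p (k + 1 : ℕ)
  rw [if_neg (by omega), show ((k + 1 : ℕ) : ℤ) - 1 = k by push_cast; ring,
    show ((k + 1 : ℕ) : ℤ) + 1 = (k + 2 : ℕ) by push_cast; ring] at h
  linear_combination h

theorem sum_range_succ_trinomialCoeff_self (N : ℕ) :
    ∑ n ∈ Finset.range (N + 1), trinomialCoeff n N = 1 := by
  rw [Finset.sum_range_succ, trinomialCoeff_self, Finset.sum_eq_zero, zero_add]
  intro n hn
  rw [Finset.mem_range] at hn
  exact trinomialCoeff_eq_zero n _ (by simpa using hn)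

/-! ### Trinomial coefficients modulo a prime -/

/-- The sum of the `e`-th powers of the two primitive cube roots of unity. -/
def cubeTrace (e : ℤ) : ℤ := if 3 ∣ e then 2 else -1

theorem not_prime_dvd_of_lt {p k : ℕ} (h0 : 0 < k) (hk : k < p) : ¬ (p : ℤ) ∣ k := by
  rw [Int.natCast_dvd_natCast]
  exact Nat.not_dvd_of_pos_of_lt h0 hk

section Prime

variable {p : ℕ} [hp : Fact p.Prime]

theorem prime_dvd_trinomialCoeff {k : ℕ} (h0 : 0 < k) (hk : k < p) :
    (p : ℤ) ∣ trinomialCoeff p k := by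
  obtain ⟨q, rfl⟩ : ∃ q, p = q + 1 := ⟨p - 1, by omega⟩
  have h : ((q + 1 : ℕ) : ℤ) ∣ k * trinomialCoeff (q + 1) k := by
    rw [mul_trinomialCoeff_succ]
    push_cast
    exact dvd_mul_right _ _
  exact ((Nat.prime_iff_prime_int.mp hp.out).dvd_or_dvd h).resolve_left (not_prime_dvd_of_lt h0 hk)

/-- The values `1, -1, 0` are the coefficients of `1 / (1 + x + x ^ 2) = (1 - x) / (1 - x ^ 3)`.
Since `p ∣ T(p, k)` for `0 < k < p`, three consecutive entries of row `p - 1` sum to zero modulo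
`p`; two neighbours are carried so that the induction closes. -/
theorem trinomialCoeff_pred_modEq (q : ℕ) (hq : q + 1 = p) (e : ℕ) (he : e ≤ q) :
    trinomialCoeff q ((q : ℤ) - e) ≡ (if 3 ∣ e then 1 else if 3 ∣ e + 2 then -1 else 0) [ZMOD p] ∧
    trinomialCoeff q ((q : ℤ) - e + 1) ≡
      (if 3 ∣ e + 2 then 1 else if 3 ∣ e + 1 then -1 else 0) [ZMOD p] := by
  subst hq
  induction e with
  | zero =>
    simp [trinomialCoeff_self, trinomialCoeff_eq_zero q (q + 1) (by grind)]
  | succ e ih =>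
    obtain ⟨h1, h2⟩ := ih (by omega)
    have h3 : ((q + 1 : ℕ) : ℤ) ∣ trinomialCoeff (q + 1) ((q : ℤ) - e) := by
      have := prime_dvd_trinomialCoeff (p := q + 1) (k := q - e) (by omega) (by omega)
      rwa [Nat.cast_sub (by omega)] at this
    rw [trinomialCoeff_succ, ← Int.modEq_zero_iff_dvd] at h3
    have h4 := (h3.sub h1).sub h2
    constructor
    · convert! h4 using 1
      · push_cast; ring_nf
      · split_ifs <;> omega
    · convert! h1 using 1
      · push_cast; ring_nf
      · split_ifs <;> omega

/-- For `0 < k < p`, the number `k * trinomialCoeff p k` modulo `p ^ 2`. -/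
theorem mul_trinomialCoeff_modEq {k : ℕ} (h0 : 0 < k) (hk : k < p) :
    k * trinomialCoeff p k ≡ p * cubeTrace ((p : ℤ) - k) [ZMOD p ^ 2] := by
  obtain ⟨q, rfl⟩ : ∃ q, p = q + 1 := ⟨p - 1, by omega⟩
  have h1 := (trinomialCoeff_pred_modEq q rfl (q + 1 - k) (by omega)).1
  have h2 : trinomialCoeff q ((q : ℤ) - (q - k : ℕ) + 1) ≡
      (if 3 ∣ q - k + 2 then 1 else if 3 ∣ q - k + 1 then -1 else 0) [ZMOD (q + 1 : ℕ)] :=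
    (trinomialCoeff_pred_modEq q rfl (q - k) (by omega)).2
  have h3 := (h1.sub h2).mul_left' (c := ((q + 1 : ℕ) : ℤ))
  rw [mul_trinomialCoeff_succ, sq]
  convert! h3 using 1
  · rw [Nat.cast_sub (by omega), Nat.cast_sub (by omega)]
    push_cast
    ring_nf
  · congr 1
    rw [cubeTrace]
    split_ifs <;> omega

theorem prime_dvd_coeff_X_add_neg_one_pow {k : ℕ} (h0 : 0 < k) (hk : k < p) :
    (p : ℤ) ∣ ((Polynomial.X + Polynomial.C (-1) : Polynomial ℤ) ^ p).coeff k := by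
  rw [Polynomial.coeff_X_add_C_pow]
  exact dvd_mul_of_dvd_right (Int.natCast_dvd_natCast.mpr (hp.out.dvd_choose_self h0.ne' hk)) _

/-- Compare the coefficients of `X ^ p` in `(X - 1) ^ p * (1 + X + X ^ 2) ^ p = (X ^ 3 - 1) ^ p`. -/
theorem central_trinomialCoeff_modEq (h3 : 3 < p) : trinomialCoeff p 0 ≡ 1 [ZMOD p ^ 2] := by
  have hodd : Odd p := hp.out.odd_of_ne_two (by omega)
  have key : (Polynomial.X + Polynomial.C (-1) : Polynomial ℤ) ^ p *
      (1 + Polynomial.X + Polynomial.X ^ 2) ^ p =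
        Polynomial.expand ℤ 3 ((Polynomial.X + Polynomial.C (-1)) ^ p) := by
    rw [← mul_pow, map_pow]
    congr 1
    simp
    ring
  have hc := congrArg (fun f => Polynomial.coeff f p) key
  have hnd : ¬ 3 ∣ p := fun h => by
    have := (Nat.prime_dvd_prime_iff_eq Nat.prime_three hp.out).mp h
    omega
  simp only [Polynomial.coeff_expand (by norm_num : 0 < 3), if_neg hnd, Polynomial.coeff_mul] at hc
  rw [Finset.Nat.sum_antidiagonal_eq_sum_range_succ_mk, Finset.sum_range_succ] at hc
  obtain ⟨q, hq⟩ : ∃ q, p = q + 1 := ⟨p - 1, by omega⟩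
  -- The coefficient on the right vanishes as `3 ∤ p`. On the left, each inner term has two factors
  -- divisible by `p`; the end terms are `-T(p, 0)` and `1`.
  have hmid : ((p : ℤ) ^ 2) ∣ ∑ i ∈ Finset.range q,
      ((Polynomial.X + Polynomial.C (-1) : Polynomial ℤ) ^ p).coeff (i + 1) *
        ((1 + Polynomial.X + Polynomial.X ^ 2 : Polynomial ℤ) ^ p).coeff (p - (i + 1)) := by
    refine Finset.dvd_sum fun i hi => ?_
    rw [Finset.mem_range] at hi
    rw [sq]
    refine mul_dvd_mul (prime_dvd_coeff_X_add_neg_one_pow (by omega) (by omega)) ?_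
    rw [coeff_one_add_X_add_X_sq_pow, Nat.cast_sub (by omega), ← trinomialCoeff_neg]
    convert! prime_dvd_trinomialCoeff (p := p) (k := i + 1) (by omega) (by omega) using 2
    ring
  have hsplit : ∑ i ∈ Finset.range p,
      ((Polynomial.X + Polynomial.C (-1) : Polynomial ℤ) ^ p).coeff i *
        ((1 + Polynomial.X + Polynomial.X ^ 2 : Polynomial ℤ) ^ p).coeff (p - i) =
      ∑ i ∈ Finset.range q,
      ((Polynomial.X + Polynomial.C (-1) : Polynomial ℤ) ^ p).coeff (i + 1) *
        ((1 + Polynomial.X + Polynomial.X ^ 2 : Polynomial ℤ) ^ p).coeff (p - (i + 1)) +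
      -trinomialCoeff p 0 := by
    nth_rw 1 [hq]
    rw [Finset.sum_range_succ']
    congr 1
    rw [Polynomial.coeff_X_add_C_pow, coeff_one_add_X_add_X_sq_pow]
    simp [hodd.neg_one_pow]
  have htop : ((Polynomial.X + Polynomial.C (-1) : Polynomial ℤ) ^ p).coeff p *
      ((1 + Polynomial.X + Polynomial.X ^ 2 : Polynomial ℤ) ^ p).coeff (p - p) = 1 := by
    rw [Polynomial.coeff_X_add_C_pow, coeff_one_add_X_add_X_sq_pow, Nat.sub_self,
      ← trinomialCoeff_neg]
    simp [trinomialCoeff_self]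
  rw [hsplit, htop] at hc
  refine Int.ModEq.symm ((Int.modEq_iff_dvd).mpr ?_)
  convert! hmid using 1
  linarith

end Prime

/-! ### The Lucas sequence `lucasS` and its companion -/

/-- The companion of `lucasS`: `(2 + √3) ^ n = lucasC n + lucasS n * √3`. -/
def lucasC (n : ℕ) : ℤ := lucasS (n + 1) - 2 * lucasS n

theorem lucasS_succ (n : ℕ) : lucasS (n + 1) = lucasC n + 2 * lucasS n := by
  rw [lucasC]
  ring

theorem lucasC_succ (n : ℕ) : lucasC (n + 1) = 2 * lucasC n + 3 * lucasS n := by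
  rw [lucasC, lucasC, show lucasS (n + 1 + 1) = 4 * lucasS (n + 1) - lucasS n from rfl]
  ring

theorem lucasC_sq (n : ℕ) : lucasC n ^ 2 = 1 + 3 * lucasS n ^ 2 := by
  induction n with
  | zero => simp [lucasC, lucasS]
  | succ n ih =>
    rw [lucasS_succ, lucasC_succ]
    linear_combination ih

theorem two_add_sqrt_three_pow {R : Type*} [CommRing R] {s : R} (hs : s ^ 2 = 3) (n : ℕ) :
    (2 + s) ^ n = lucasC n + lucasS n * s := by
  induction n with
  | zero => simp [lucasC, lucasS]
  | succ n ih =>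
    rw [pow_succ, ih, lucasS_succ, lucasC_succ]
    push_cast
    linear_combination (lucasS n : R) * hs

section Prime

variable {p : ℕ} [hp : Fact p.Prime]

/-- Both coordinates of `(1 + √3) ^ p ≡ 1 + √3 ^ p` modulo `p`. -/
theorem one_add_sqrt_three_pow_prime {h : ℕ} (hh : p = 2 * h + 1) :
    (2 : ZMod p) ^ h * (lucasC h + 3 * lucasS h) = 1 ∧
    (2 : ZMod p) ^ h * (lucasC h + lucasS h) = 3 ^ h := by
  obtain ⟨r, hr⟩ := exists_add_pow_prime_eq hp.out (1 : ℤ√3) Zsqrtd.sqrtd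
  have hs : (Zsqrtd.sqrtd : ℤ√3) ^ 2 = 3 := by
    rw [sq, Zsqrtd.dmuld]; rfl
  have h1 : (1 + Zsqrtd.sqrtd : ℤ√3) ^ p =
      (1 + Zsqrtd.sqrtd) * (((2 ^ h : ℤ) : ℤ√3) *
        ((lucasC h : ℤ√3) + (lucasS h : ℤ√3) * Zsqrtd.sqrtd)) := by
    -- `(1 + √3) ^ 2 = 2 * (2 + √3)` brings in the Lucas pair.
    rw [← two_add_sqrt_three_pow hs, hh, pow_succ, pow_mul,
      show (1 + Zsqrtd.sqrtd : ℤ√3) ^ 2 = 2 * (2 + Zsqrtd.sqrtd) by linear_combination hs, mul_pow]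
    push_cast
    ring
  have h2 : (Zsqrtd.sqrtd : ℤ√3) ^ p = ((3 ^ h : ℤ) : ℤ√3) * Zsqrtd.sqrtd := by
    nth_rw 1 [hh]
    rw [pow_succ, pow_mul, hs]
    push_cast
    rfl
  rw [h1, h2, one_pow] at hr
  have e2 : (2 : ZMod p) ^ h = ((2 ^ h : ℤ) : ZMod p) := by push_cast; rfl
  have e3 : (3 : ZMod p) ^ h = ((3 ^ h : ℤ) : ZMod p) := by push_cast; rfl
  rw [e2, e3]
  generalize (2 ^ h : ℤ) = A at *
  generalize (3 ^ h : ℤ) = B at *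
  have hre := congrArg (fun z : ℤ√3 => ((z.re : ℤ) : ZMod p)) hr
  have him := congrArg (fun z : ℤ√3 => ((z.im : ℤ) : ZMod p)) hr
  simp at hre him
  exact ⟨by linear_combination hre, by linear_combination him⟩

/-- The norm equation gives `(δ - a) * (δ + a) = -3 * b ^ 2`, and `p` cannot divide the second
factor, since it would then divide `2 * δ`. -/
theorem modEq_prime_sq_of_sq {a b δ : ℤ} (h2 : p ≠ 2) (hδ : δ = 1 ∨ δ = -1)
    (hab : a ^ 2 = 1 + 3 * b ^ 2) (hb : (p : ℤ) ∣ b) (ha : a ≡ δ [ZMOD p]) :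
    a ≡ δ [ZMOD p ^ 2] := by
  have hpp := Nat.prime_iff_prime_int.mp hp.out
  have hδ2 : δ ^ 2 = 1 := by rcases hδ with rfl | rfl <;> norm_num
  have h1 : (p : ℤ) ^ 2 ∣ (δ - a) * (δ + a) := by
    rw [show (δ - a) * (δ + a) = b ^ 2 * (-3) by linear_combination hδ2 - hab]
    exact dvd_mul_of_dvd_left (pow_dvd_pow_of_dvd hb 2) _
  have h3 : ¬ (p : ℤ) ∣ δ + a := fun h => by
    have h4 := dvd_add h ha.dvd
    have h5 : (p : ℤ) ∣ 2 := by
      rcases hδ with rfl | rfl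
      · simpa using h4
      · rw [← dvd_neg]; simpa using h4
    have h6 := (Nat.prime_dvd_prime_iff_eq hp.out Nat.prime_two).mp (by exact_mod_cast h5)
    exact h2 h6
  rw [Int.modEq_iff_dvd]
  exact (((Prime.coprime_iff_not_dvd hpp).mpr h3).pow_left).dvd_of_dvd_mul_right h1

/-- By Euler's criterion `2 ^ h` and `3 ^ h` become Legendre symbols in the two Frobenius
coordinates. Their difference isolates `lucasS h`, their sum `lucasS (h + 1) = lucasC h + 2 * lucasS
h`; the sign of `(3/p)` decides which one vanishes. -/
theorem lucas_modEq_of_legendreSym_three {h : ℕ} (hh : p = 2 * h + 1) :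
    (legendreSym p 3 = 1 → (p : ℤ) ∣ lucasS h ∧ lucasC h ≡ legendreSym p 2 [ZMOD p ^ 2]) ∧
    (legendreSym p 3 = -1 →
      (p : ℤ) ∣ lucasS (h + 1) ∧ lucasC (h + 1) ≡ -legendreSym p 2 [ZMOD p ^ 2]) := by
  have hp2 : p ≠ 2 := by omega
  have two_ne : (2 : ZMod p) ≠ 0 := by
    intro h
    have : ((2 : ℕ) : ZMod p) = 0 := by exact_mod_cast h
    rw [ZMod.natCast_eq_zero_iff, Nat.prime_dvd_prime_iff_eq hp.out Nat.prime_two] at this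
    exact hp2 this
  have hdiv : p / 2 = h := by omega
  have e2 := legendreSym.eq_pow p 2
  have e3 := legendreSym.eq_pow p 3
  rw [hdiv] at e2 e3
  push_cast at e2 e3
  have hδ : legendreSym p 2 = 1 ∨ legendreSym p 2 = -1 :=
    legendreSym.eq_one_or_neg_one p (by exact_mod_cast two_ne)
  obtain ⟨h1, h2⟩ := one_add_sqrt_three_pow_prime hh
  rw [← e2] at h1 h2
  rw [← e3] at h2
  have hx : (legendreSym p 2 : ZMod p) ^ 2 = 1 := by
    rcases hδ with h | h <;> rw [h] <;> norm_num
  generalize legendreSym p 2 = δ at *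
  have hx0 : (δ : ZMod p) ≠ 0 := by rintro h; rw [h] at hx; simp at hx
  constructor <;> intro hε <;> rw [hε] at h2 <;> push_cast at h2
  · have hS : (lucasS h : ZMod p) = 0 := by
      have : 2 * (δ * (lucasS h : ZMod p)) = 0 := by linear_combination h1 - h2
      simpa [two_ne, hx0] using this
    have hd := (ZMod.intCast_zmod_eq_zero_iff_dvd _ p).mp hS
    refine ⟨hd, modEq_prime_sq_of_sq hp2 hδ (lucasC_sq h) hd ?_⟩
    rw [← ZMod.intCast_eq_intCast_iff]
    linear_combination (δ : ZMod p) * h1 - (lucasC h + 3 * lucasS h : ZMod p) * hx - 3 * hS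
  · have hS : (lucasS (h + 1) : ZMod p) = 0 := by
      have : 2 * (δ * (lucasS (h + 1) : ZMod p)) = 0 := by
        rw [lucasS_succ]; push_cast; linear_combination h1 + h2
      simpa [two_ne, hx0] using this
    have hd := (ZMod.intCast_zmod_eq_zero_iff_dvd _ p).mp hS
    refine ⟨hd, modEq_prime_sq_of_sq hp2 (by grind) (lucasC_sq _) hd ?_⟩
    rw [← ZMod.intCast_eq_intCast_iff]
    rw [lucasS_succ] at hS
    rw [lucasC_succ]
    push_cast at hS ⊢
    linear_combination (δ : ZMod p) * h2 - (lucasC h + lucasS h : ZMod p) * hx + hS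

end Prime

/-! ### Lacunary binomial sums -/

theorem sum_range_two_mul {M : Type*} [AddCommMonoid M] (f : ℕ → M) (n : ℕ) :
    ∑ i ∈ Finset.range (2 * n), f i = ∑ j ∈ Finset.range n, (f (2 * j) + f (2 * j + 1)) := by
  induction n with
  | zero => simp
  | succ n ih =>
    rw [show 2 * (n + 1) = 2 * n + 1 + 1 by ring, Finset.sum_range_succ, Finset.sum_range_succ, ih,
      Finset.sum_range_succ, add_assoc]

/-- The sum of `(-1) ^ j * choose N (2 * j + 1) * (ω ^ e + ω ^ (-e))`, where `e = N - 2 * j - 1`,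
`ω` is a primitive cube root of unity, and `N = 2 * h + 1`. -/
def twistedChooseSum (h : ℕ) : ℤ :=
  ∑ j ∈ Finset.range (h + 1), (-1) ^ j * ((2 * h + 1).choose (2 * j + 1) : ℤ) *
    cubeTrace (2 * h + 1 - (2 * j + 1 : ℕ))

/-- Subtracting the conjugate in `i` keeps the odd binomial terms; adding the cases `w` and `w ^ 2`
produces `cubeTrace`. -/
theorem sub_pow_eq_twistedChooseSum {R : Type*} [CommRing R] {i w : R} (hi : i ^ 2 = -1)
    (hw : w ^ 2 + w + 1 = 0) (h : ℕ) :
    (w + i) ^ (2 * h + 1) - (w - i) ^ (2 * h + 1) +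
      ((w ^ 2 + i) ^ (2 * h + 1) - (w ^ 2 - i) ^ (2 * h + 1)) = 2 * i * twistedChooseSum h := by
  have hw3 : w ^ 3 = 1 := by linear_combination (w - 1) * hw
  have htr (e : ℕ) : w ^ e + (w ^ 2) ^ e = cubeTrace e := by
    have he : w ^ e = w ^ (e % 3) := by
      conv_lhs => rw [← Nat.div_add_mod e 3, pow_add, pow_mul, hw3, one_pow, one_mul]
    rw [← pow_mul, mul_comm 2 e, pow_mul, he]
    have : e % 3 < 3 := Nat.mod_lt _ (by norm_num)
    rw [cubeTrace]
    split_ifs with h3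
    · rw [show e % 3 = 0 by omega]; norm_num
    · obtain h | h : e % 3 = 1 ∨ e % 3 = 2 := by omega
      · rw [h]; push_cast; linear_combination hw
      · rw [h]; push_cast; linear_combination hw + w * hw3
  have hex (v : R) : (v + i) ^ (2 * h + 1) - (v - i) ^ (2 * h + 1) =
      2 * i * ∑ j ∈ Finset.range (h + 1),
        (-1) ^ j * ((2 * h + 1).choose (2 * j + 1) : R) * v ^ (2 * h + 1 - (2 * j + 1)) := by
    rw [sub_eq_add_neg v i, add_comm v i, add_comm v (-i), add_pow, add_pow,
      ← Finset.sum_sub_distrib, show 2 * h + 1 + 1 = 2 * (h + 1) by ring, sum_range_two_mul,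
      Finset.mul_sum]
    refine Finset.sum_congr rfl fun j _ => ?_
    rw [pow_succ, pow_succ, pow_mul, pow_mul, neg_sq, hi]
    ring
  rw [hex, hex, ← mul_add, ← Finset.sum_add_distrib, twistedChooseSum]
  push_cast
  congr 1
  refine Finset.sum_congr rfl fun j hj => ?_
  rw [Finset.mem_range] at hj
  rw [← mul_add, htr, Nat.cast_sub (by omega)]
  push_cast
  ring_nf

/-- Each base squares to a twelfth root of unity times `2 ± s`, for instance `(w + i) ^ 2 = w * i *
(2 + s)`. The sixth power of that root is `-1`, hence the splitting `6 * t + r`. -/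
theorem twistedChooseSum_eq_complex (t r : ℕ) : ∃ w i s : ℂ, i ^ 2 = -1 ∧ s ^ 2 = 3 ∧
    2 * w = -1 + i * s ∧ (2 * i * twistedChooseSum (6 * t + r) : ℂ) =
      (-1) ^ t * ((w + i) * (w * i) ^ r * (lucasC (6 * t + r) + lucasS (6 * t + r) * s) -
        (w - i) * (-(w * i)) ^ r * (lucasC (6 * t + r) - lucasS (6 * t + r) * s) +
       ((w ^ 2 + i) * (w ^ 2 * i) ^ r * (lucasC (6 * t + r) - lucasS (6 * t + r) * s) -
        (w ^ 2 - i) * (-(w ^ 2 * i)) ^ r * (lucasC (6 * t + r) + lucasS (6 * t + r) * s))) := by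
  have hi : Complex.I ^ 2 = -1 := Complex.I_sq
  have hs : ((√3 : ℝ) : ℂ) ^ 2 = 3 := by
    rw [← Complex.ofReal_pow, Real.sq_sqrt (by norm_num)]; norm_num
  generalize Complex.I = i at *
  generalize ((√3 : ℝ) : ℂ) = s at *
  obtain ⟨w, hw⟩ : ∃ w : ℂ, 2 * w = -1 + i * s := ⟨(-1 + i * s) / 2, by ring⟩
  refine ⟨w, i, s, hi, hs, hw, ?_⟩
  have hw' : w = (-1 + i * s) / 2 := by rw [← hw]; ring
  have hw2 : w ^ 2 + w + 1 = 0 := by rw [hw']; linear_combination s ^ 2 / 4 * hi - hs / 4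
  have hw3 : w ^ 3 = 1 := by linear_combination (w - 1) * hw2
  rw [← sub_pow_eq_twistedChooseSum hi hw2]
  have hs' : (-s) ^ 2 = 3 := by rw [neg_sq, hs]
  have hwi : w - w ^ 2 = i * s := by linear_combination hw - hw2
  have p1 := two_add_sqrt_three_pow hs (6 * t + r)
  have p2 := two_add_sqrt_three_pow hs' (6 * t + r)
  have hpow (v z : ℂ) (u : ℂ) (hz : v ^ 2 = z * u) (hz6 : z ^ 6 = -1) :
      v ^ (2 * (6 * t + r) + 1) = (-1) ^ t * (v * z ^ r * u ^ (6 * t + r)) := by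
    rw [pow_succ, pow_mul, hz, mul_pow, pow_add, pow_mul, hz6]
    ring
  have hi6 : i ^ 6 = -1 := by linear_combination (i ^ 4 - i ^ 2 + 1) * hi
  rw [hpow (w + i) (w * i) (2 + s), hpow (w - i) (-(w * i)) (2 + -s),
    hpow (w ^ 2 + i) (w ^ 2 * i) (2 + -s), hpow (w ^ 2 - i) (-(w ^ 2 * i)) (2 + s), p1, p2]
  · ring
  · linear_combination -w ^ 2 * hwi + hi + hw3
  · linear_combination i ^ 6 * (w ^ 6 + 1) * (w ^ 3 + 1) * hw3 + hi6
  · linear_combination -w ^ 2 * hwi + hi + hw3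
  · linear_combination i ^ 6 * (w ^ 6 + 1) * (w ^ 3 + 1) * hw3 + hi6
  · linear_combination w * hwi + hi + hw3
  · linear_combination i ^ 6 * (w ^ 3 + 1) * hw3 + hi6
  · linear_combination w * hwi + hi + hw3
  · linear_combination i ^ 6 * (w ^ 3 + 1) * hw3 + hi6

/-- The omitted residues `r = 1, 4` make `2 * (6 * t + r) + 1` divisible by `3`. -/
theorem twistedChooseSum_eq (t r : ℕ) :
    (r = 0 ∨ r = 5 → twistedChooseSum (6 * t + r) =
      (-1) ^ t * (2 * lucasC (6 * t + r) + 3 * lucasS (6 * t + r))) ∧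
    (r = 2 ∨ r = 3 → twistedChooseSum (6 * t + r) = (-1) ^ t * lucasC (6 * t + r)) := by
  obtain ⟨w, i, s, hi, hs, hw, h⟩ := twistedChooseSum_eq_complex t r
  have hi0 : (2 * i : ℂ) ≠ 0 := by rintro h0; grind
  generalize twistedChooseSum (6 * t + r) = G at *
  generalize lucasC (6 * t + r) = a at *
  generalize lucasS (6 * t + r) = b at *
  have hw2 : w ^ 2 = -w - 1 := by
    have hw' : w = (-1 + i * s) / 2 := by rw [← hw]; ring
    rw [hw']
    linear_combination s ^ 2 / 4 * hi - hs / 4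
  have his : i * s = 2 * w + 1 := by linear_combination -hw
  constructor <;> rintro (rfl | rfl) <;> rw [← Int.cast_inj (α := ℂ)] <;>
    refine mul_left_cancel₀ hi0 (h.trans ?_) <;> push_cast <;> rw [mul_left_comm] <;> congr 1 <;>
    clear h <;> grind

section Prime

variable {p : ℕ} [hp : Fact p.Prime]

/-- Quadratic reciprocity for `3`, `2` and `-2`, by residues modulo `24`. -/
theorem legendreSym_mod_twelve (hp3 : 3 < p) (t r : ℕ) (h : p = 12 * t + r) :
    (r = 1 → legendreSym p 3 = 1 ∧ legendreSym p 2 = (-1) ^ t ∧ legendreSym p (-2) = (-1) ^ t) ∧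
    (r = 5 → legendreSym p 3 = -1 ∧ legendreSym p 2 = -(-1) ^ t ∧
      legendreSym p (-2) = -(-1) ^ t) ∧
    (r = 7 → legendreSym p 3 = -1 ∧ legendreSym p 2 = (-1) ^ t ∧
      legendreSym p (-2) = -(-1) ^ t) ∧
    (r = 11 → legendreSym p 3 = 1 ∧ legendreSym p 2 = -(-1) ^ t ∧
      legendreSym p (-2) = (-1) ^ t) := by
  have hp2 : p ≠ 2 := by omega
  rw [legendreSym.at_two hp2, legendreSym.at_neg_two hp2]
  have hr := legendreSym.quadratic_reciprocity' (p := 3) (q := p) (by norm_num) hp2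
  have h8 : (p : ZMod 8) = ((p % 8 : ℕ) : ZMod 8) := by simp
  have h31 : legendreSym 3 1 = 1 := by decide
  have h32 : legendreSym 3 2 = -1 := by decide
  rw [legendreSym.mod 3 p] at hr
  push_cast at hr
  rw [hr, h8]
  -- The symbols of `2` and `-2` depend on `p` modulo `8`, so the parity of `t` is needed.
  obtain ⟨u, ht | ht⟩ := Nat.even_or_odd' t <;>
  refine ⟨?_, ?_, ?_, ?_⟩ <;> rintro rfl
  all_goals
    first
    | rw [show (p : ℤ) % 3 = 1 by omega, h31]
    | rw [show (p : ℤ) % 3 = 2 by omega, h32]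
    first
    | rw [Even.neg_one_pow (n := 3 / 2 * (p / 2)) (by rw [Nat.even_iff]; omega)]
    | rw [Odd.neg_one_pow (n := 3 / 2 * (p / 2)) (by rw [Nat.odd_iff]; omega)]
    first
    | rw [show p % 8 = 1 by omega]
    | rw [show p % 8 = 3 by omega]
    | rw [show p % 8 = 5 by omega]
    | rw [show p % 8 = 7 by omega]
    first
    | rw [Even.neg_one_pow (n := t) ⟨u, by omega⟩]
    | rw [Odd.neg_one_pow (n := t) ⟨u, by omega⟩]
    decide

/-- The binomial sum governing the congruence for even index, modulo `p ^ 2`. -/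
theorem twistedChooseSum_modEq (hp3 : 3 < p) {h : ℕ} (hh : p = 2 * h + 1) :
    (p : ℤ) ∣ lucasS (((p : ℤ) - legendreSym p 3) / 2).toNat ∧
    twistedChooseSum h ≡ 2 * (-1) ^ h +
      3 * legendreSym p (-2) * lucasS (((p : ℤ) - legendreSym p 3) / 2).toNat [ZMOD p ^ 2] := by
  have hpr := hp.out
  have h12 : p % 12 = 1 ∨ p % 12 = 5 ∨ p % 12 = 7 ∨ p % 12 = 11 := by
    have h2 : p % 3 ≠ 0 := fun h0 => by
      have := (Nat.prime_dvd_prime_iff_eq Nat.prime_three hpr).mp (Nat.dvd_of_mod_eq_zero h0)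
      omega
    omega
  obtain ⟨t, r, hr⟩ : ∃ t r, p = 12 * t + r ∧ r = p % 12 := ⟨p / 12, p % 12, by omega, rfl⟩
  obtain ⟨hpt, hr⟩ := hr
  obtain ⟨q1, q5, q7, q11⟩ := legendreSym_mod_twelve hp3 t r hpt
  obtain ⟨l1, l2⟩ := lucas_modEq_of_legendreSym_three hh
  rw [← hr] at h12
  have hsq : ((-1 : ℤ) ^ t) ^ 2 = 1 := by rw [← pow_mul, mul_comm, pow_mul]; norm_num
  rcases h12 with rfl | rfl | rfl | rfl
  · obtain ⟨e3, e2, em2⟩ := q1 rfl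
    obtain ⟨d1, d2⟩ := l1 e3
    obtain rfl : h = 6 * t + 0 := by omega
    have hm : (((p : ℤ) - legendreSym p 3) / 2).toNat = 6 * t + 0 := by rw [e3]; omega
    rw [hm, em2, (twistedChooseSum_eq t 0).1 (by simp)]
    refine ⟨d1, ?_⟩
    rw [e2, Int.modEq_iff_dvd] at d2
    have hs : (-1 : ℤ) ^ (6 * t + 0) = 1 := by rw [pow_add, pow_mul]; norm_num
    rw [hs, Int.modEq_iff_dvd]
    convert! d2.mul_left (2 * (-1) ^ t) using 1
    linear_combination -2 * hsq
  · obtain ⟨e3, e2, em2⟩ := q5 rfl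
    obtain ⟨d1, d2⟩ := l2 e3
    obtain rfl : h = 6 * t + 2 := by omega
    have hm : (((p : ℤ) - legendreSym p 3) / 2).toNat = 6 * t + 2 + 1 := by rw [e3]; omega
    rw [hm, em2, (twistedChooseSum_eq t 2).2 (by simp)]
    refine ⟨d1, ?_⟩
    -- Multiplication by `2 - √3` gives `lucasC h = 2 * lucasC (h + 1) - 3 * lucasS (h + 1)`, which
    -- turns the closed form at `h` into one at `h + 1`.
    rw [e2, Int.modEq_iff_dvd, lucasC_succ] at d2
    have hs : (-1 : ℤ) ^ (6 * t + 2) = 1 := by rw [pow_add, pow_mul]; norm_num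
    rw [hs, Int.modEq_iff_dvd, lucasS_succ]
    convert! d2.mul_left (2 * (-1) ^ t) using 1
    linear_combination -2 * hsq
  · obtain ⟨e3, e2, em2⟩ := q7 rfl
    obtain ⟨d1, d2⟩ := l2 e3
    obtain rfl : h = 6 * t + 3 := by omega
    have hm : (((p : ℤ) - legendreSym p 3) / 2).toNat = 6 * t + 3 + 1 := by rw [e3]; omega
    rw [hm, em2, (twistedChooseSum_eq t 3).2 (by simp)]
    refine ⟨d1, ?_⟩
    rw [e2, Int.modEq_iff_dvd, lucasC_succ] at d2
    have hs : (-1 : ℤ) ^ (6 * t + 3) = -1 := by rw [pow_add, pow_mul]; norm_num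
    rw [hs, Int.modEq_iff_dvd, lucasS_succ]
    convert! d2.mul_left (2 * (-1) ^ t) using 1
    linear_combination 2 * hsq
  · obtain ⟨e3, e2, em2⟩ := q11 rfl
    obtain ⟨d1, d2⟩ := l1 e3
    obtain rfl : h = 6 * t + 5 := by omega
    have hm : (((p : ℤ) - legendreSym p 3) / 2).toNat = 6 * t + 5 := by rw [e3]; omega
    rw [hm, em2, (twistedChooseSum_eq t 5).1 (by simp)]
    refine ⟨d1, ?_⟩
    rw [e2, Int.modEq_iff_dvd] at d2
    have hs : (-1 : ℤ) ^ (6 * t + 5) = -1 := by rw [pow_add, pow_mul]; norm_num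
    rw [hs, Int.modEq_iff_dvd]
    convert! d2.mul_left (2 * (-1) ^ t) using 1
    linear_combination 2 * hsq

theorem mul_choose_prime_modEq {k : ℕ} (h0 : 0 < k) (hk : k < p) :
    k * (p.choose k : ℤ) ≡ p * (-1) ^ (k - 1) [ZMOD p ^ 2] := by
  have hc (j : ℕ) (hj : j < p) : ((p - 1).choose j : ℤ) ≡ (-1) ^ j [ZMOD p] := by
    induction j with
    | zero => simp
    | succ j ih =>
      have h1 : ((p.choose (j + 1) : ℕ) : ℤ) ≡ 0 [ZMOD p] := by
        rw [Int.modEq_zero_iff_dvd, Int.natCast_dvd_natCast]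
        exact hp.out.dvd_choose_self (by omega) hj
      have hs := Nat.choose_succ_succ (p - 1) j
      rw [Nat.succ_eq_add_one, Nat.succ_eq_add_one, Nat.sub_add_cancel hp.out.pos] at hs
      rw [hs] at h1
      have h2 := h1.sub (ih (by omega))
      push_cast at h2
      convert! h2 using 1
      · simp
      · ring
  obtain ⟨j, rfl⟩ : ∃ j, k = j + 1 := ⟨k - 1, by omega⟩
  have h3 := Nat.add_one_mul_choose_eq (p - 1) j
  rw [Nat.sub_add_cancel hp.out.pos] at h3
  rw [sq, show ((j + 1 : ℕ) : ℤ) * (p.choose (j + 1) : ℤ) = p * ((p - 1).choose j : ℤ) by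
    exact_mod_cast (by rw [h3, mul_comm] )]
  exact (hc j (by omega)).mul_left'

/-- Both sides agree after multiplication by `k`, which is prime to `p`; oddness makes the sign in
`k * choose p k ≡ p * (-1) ^ (k - 1)` positive. -/
theorem trinomialCoeff_modEq_choose {k : ℕ} (hk : k < p) (hodd : Odd k) :
    trinomialCoeff p k ≡ p.choose k * cubeTrace ((p : ℤ) - k) [ZMOD p ^ 2] := by
  have h1 := mul_trinomialCoeff_modEq hodd.pos hk
  have h2 := (mul_choose_prime_modEq hodd.pos hk).mul_right (cubeTrace ((p : ℤ) - k))
  rw [(Nat.Odd.sub_odd hodd odd_one).neg_one_pow, mul_one] at h2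
  have h3 := (h1.trans h2.symm).dvd
  rw [mul_assoc, ← mul_sub] at h3
  have hpp := Nat.prime_iff_prime_int.mp hp.out
  rw [Int.modEq_iff_dvd]
  exact (((Prime.coprime_iff_not_dvd hpp).mpr
    (not_prime_dvd_of_lt hodd.pos hk)).pow_left).dvd_of_dvd_mul_left h3

/-- Alternating descent from index `2 * h` to index `0`. -/
theorem sum_trinomialCoeff_zero_eq (N m : ℕ) :
    ∑ n ∈ Finset.range N, trinomialCoeff n 0 =
      ∑ j ∈ Finset.range m, (-1) ^ j * trinomialCoeff N (2 * j + 1 : ℕ) +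
        (-1) ^ m * ∑ n ∈ Finset.range N, trinomialCoeff n (2 * m : ℕ) := by
  induction m with
  | zero => simp
  | succ m ih =>
    have h := sum_range_trinomialCoeff_add N (2 * m + 1 : ℕ)
    rw [if_neg (by omega)] at h
    rw [show ((2 * m + 1 : ℕ) : ℤ) - 1 = (2 * m : ℕ) by push_cast; ring,
      show ((2 * m + 1 : ℕ) : ℤ) + 1 = (2 * (m + 1) : ℕ) by push_cast; ring] at h
    rw [ih, Finset.sum_range_succ, pow_succ]
    linear_combination (-1) ^ m * h

theorem sum_central_trinomialCoeff_modEq (hp3 : 3 < p) :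
    ∑ n ∈ Finset.range p, trinomialCoeff n 0 ≡ (-1) ^ ((p - 1) / 2) +
      3 * legendreSym p (-2) * lucasS (((p : ℤ) - legendreSym p 3) / 2).toNat [ZMOD p ^ 2] := by
  obtain ⟨h, hh⟩ := hp.out.odd_of_ne_two (by omega)
  have h1 := (twistedChooseSum_modEq hp3 hh).2
  have htop := sum_range_succ_trinomialCoeff_self (2 * h)
  rw [← hh] at htop
  rw [show (p - 1) / 2 = h by omega, sum_trinomialCoeff_zero_eq p h, htop]
  have hsum : ∑ j ∈ Finset.range h, (-1) ^ j * trinomialCoeff p (2 * j + 1 : ℕ) ≡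
      twistedChooseSum h - 2 * (-1) ^ h [ZMOD p ^ 2] := by
    rw [twistedChooseSum, Finset.sum_range_succ]
    -- The descent stops before `k = p`, so the top term, where the trace is `2`, is split off.
    rw [show (-1) ^ h * ((2 * h + 1).choose (2 * h + 1) : ℤ) *
      cubeTrace (2 * h + 1 - (2 * h + 1 : ℕ)) = 2 * (-1) ^ h by simp [cubeTrace, mul_comm],
      add_sub_cancel_right]
    refine Int.ModEq.sum fun j hj => ?_
    rw [Finset.mem_range] at hj
    rw [mul_assoc]
    have := trinomialCoeff_modEq_choose (p := p) (k := 2 * j + 1) (by omega) (by simp)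
    nth_rw 3 [hh] at this
    nth_rw 3 [hh] at this
    push_cast at this ⊢
    exact this.mul_left _
  have h2 := (hsum.trans (h1.sub_right _)).add_right ((-1) ^ h * 1)
  convert! h2 using 1
  ring

end Prime

/-! ### Congruences between rational numbers -/

theorem not_dvd_den_div {p : ℕ} {z : ℤ} {n : ℕ} (hn : ¬ p ∣ n) : ¬ p ∣ ((z : ℚ) / n).den := by
  intro h
  have h1 := Rat.den_dvd z n
  rw [Rat.divInt_eq_div] at h1
  exact hn (h.trans (by exact_mod_cast h1))

theorem RatModEq.neg {p : ℕ} {a b : ℚ} (h : RatModEq p a b) : RatModEq p (-a) (-b) := by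
  obtain ⟨ha, hb, c, hc, e⟩ := h
  refine ⟨by rwa [Rat.neg_den], by rwa [Rat.neg_den], -c, by rwa [Rat.neg_den], ?_⟩
  linear_combination -e

theorem RatModEq.neg_one_pow_mul {p : ℕ} {a b : ℚ} (h : RatModEq p a b) (n : ℕ) :
    RatModEq p ((-1) ^ n * a) ((-1) ^ n * b) := by
  obtain hn | hn := neg_one_pow_eq_or ℚ n <;> rw [hn]
  · simpa using h
  · simpa using h.neg

section Prime

variable {p : ℕ} [hp : Fact p.Prime]

theorem not_dvd_den_add {a b : ℚ} (ha : ¬ p ∣ a.den) (hb : ¬ p ∣ b.den) : ¬ p ∣ (a + b).den :=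
  fun h => (hp.out.dvd_mul.mp (h.trans (Rat.add_den_dvd a b))).elim ha hb

theorem not_dvd_den_intCast (z : ℤ) : ¬ p ∣ (z : ℚ).den := by
  rw [Rat.den_intCast]
  exact hp.out.one_lt.ne' ∘ Nat.dvd_one.mp

theorem RatModEq.add {a b a' b' : ℚ} (h : RatModEq p a b) (h' : RatModEq p a' b') :
    RatModEq p (a + a') (b + b') := by
  obtain ⟨ha, hb, c, hc, e⟩ := h
  obtain ⟨ha', hb', c', hc', e'⟩ := h'
  refine ⟨not_dvd_den_add ha ha', not_dvd_den_add hb hb', c + c', not_dvd_den_add hc hc', ?_⟩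
  linear_combination e + e'

theorem RatModEq.sub {a b a' b' : ℚ} (h : RatModEq p a b) (h' : RatModEq p a' b') :
    RatModEq p (a - a') (b - b') := by
  rw [sub_eq_add_neg, sub_eq_add_neg]
  exact h.add h'.neg

theorem ratModEq_div_of_mul_modEq {x y : ℤ} {n : ℕ} (hn : ¬ p ∣ n) (hx : (p : ℤ) ∣ x)
    (h : n * x ≡ p * y [ZMOD p ^ 2]) : RatModEq p (x / p) (y / n) := by
  obtain ⟨u, rfl⟩ := hx
  obtain ⟨c, hc⟩ := h.symm.dvd
  have hp0 : (p : ℚ) ≠ 0 := Nat.cast_ne_zero.mpr hp.out.ne_zero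
  have hn0 : (n : ℚ) ≠ 0 := by rintro h0; rw [Nat.cast_eq_zero] at h0; simp [h0] at hn
  have hu : ((p * u : ℤ) : ℚ) / p = (u : ℤ) := by push_cast; field_simp
  rw [hu]
  refine ⟨not_dvd_den_intCast u, not_dvd_den_div hn, c / n, not_dvd_den_div hn, ?_⟩
  have hc' : ((n * (p * u) - p * y : ℤ) : ℚ) = ((p ^ 2 * c : ℤ) : ℚ) := by rw [hc]
  push_cast at hc'
  have hc2 : (n * u - y : ℚ) = p * c := mul_left_cancel₀ hp0 (by linear_combination hc')
  field_simp
  linear_combination hc2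

theorem ratModEq_div_of_modEq {x y : ℤ} (hx : (p : ℤ) ∣ x) (hy : (p : ℤ) ∣ y)
    (h : x ≡ y [ZMOD p ^ 2]) : RatModEq p (x / p) (y / p) := by
  obtain ⟨v, rfl⟩ := hy
  have h1 := ratModEq_div_of_mul_modEq (n := 1) (x := x) (y := v)
    (hp.out.one_lt.ne' ∘ Nat.dvd_one.mp) hx (by simpa using h)
  have hp0 : (p : ℚ) ≠ 0 := Nat.cast_ne_zero.mpr hp.out.ne_zero
  convert! h1 using 1
  push_cast
  field_simp

theorem trinomialCoeff_ratModEq {k : ℕ} (h0 : 0 < k) (hk : k < p) :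
    RatModEq p (trinomialCoeff p k / p) (cubeTrace ((p : ℤ) - k) / k) :=
  ratModEq_div_of_mul_modEq (Nat.not_dvd_of_pos_of_lt h0 hk) (prime_dvd_trinomialCoeff h0 hk)
    (mul_trinomialCoeff_modEq h0 hk)

/-! ### The two congruences -/

theorem sum_trinomialCoeff_odd (hp3 : 3 < p) (m : ℕ) (hm : 2 * m + 1 ≤ p - 1) :
    (p : ℤ) ∣ ∑ k ∈ Finset.range p, trinomialCoeff k (2 * m + 1 : ℕ) ∧
    RatModEq p (((∑ k ∈ Finset.range p, trinomialCoeff k (2 * m + 1 : ℕ) : ℤ) : ℚ) / p)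
      ((-1 : ℚ) ^ (m + 1) / 2 * (∑ k ∈ Finset.Icc 1 m, (-1 : ℚ) ^ k / (k : ℚ)
        - 3 * ∑ k ∈ Finset.Icc 1 m with 3 ∣ k + p, (-1 : ℚ) ^ k / (k : ℚ))) := by
  induction m with
  | zero =>
    -- At index `0` both neighbouring sums coincide by symmetry.
    have h1 := sum_range_trinomialCoeff_add p 0
    have hneg (n : ℕ) : trinomialCoeff n (0 - 1) = trinomialCoeff n (0 + 1) := by
      rw [← trinomialCoeff_neg]; rfl
    simp only [hneg] at h1
    have h2 : (p : ℤ) ^ 2 ∣ 2 * ∑ k ∈ Finset.range p, trinomialCoeff k (0 + 1) := by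
      rw [two_mul, h1]
      exact (central_trinomialCoeff_modEq hp3).symm.dvd
    have h3 : IsCoprime ((p : ℤ) ^ 2) 2 := by
      refine IsCoprime.pow_left ?_
      rw [Int.isCoprime_iff_gcd_eq_one]
      exact (Nat.coprime_primes hp.out Nat.prime_two).mpr (by omega)
    have h4 := h3.dvd_of_dvd_mul_left h2
    have h5 := (dvd_pow_self (p : ℤ) two_ne_zero).trans h4
    refine ⟨h5, ?_⟩
    have := ratModEq_div_of_modEq h5 (dvd_zero _) (Int.modEq_zero_iff_dvd.mpr h4)
    simpa using this
  | succ m ih =>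
    obtain ⟨ih1, ih2⟩ := ih (by omega)
    rw [show 2 * (m + 1) + 1 = 2 * m + 1 + 2 by ring, sum_range_trinomialCoeff_add_two]
    refine ⟨dvd_sub (prime_dvd_trinomialCoeff (by omega) (by omega)) ih1, ?_⟩
    have h := (trinomialCoeff_ratModEq (p := p) (k := 2 * m + 1 + 1)
      (by omega) (by omega)).sub ih2
    convert! h using 1
    · push_cast; ring
    · rw [Finset.sum_filter, Finset.sum_filter, Finset.sum_Icc_succ_top (by omega),
        Finset.sum_Icc_succ_top (by omega), cubeTrace]
      have hm0 : (m : ℚ) + 1 ≠ 0 := by positivity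
      -- Modulo `3`, `-2 = 1`. The trace is `-1 + 3 * [3 ∣ m + 1 + p]`, which accounts for the two
      -- sums.
      have hiff : 3 ∣ (p : ℤ) - (2 * m + 1 + 1 : ℕ) ↔ 3 ∣ m + 1 + p := by omega
      simp only [hiff, pow_succ]
      push_cast
      rw [show (2 * m + 1 + 1 : ℚ) = 2 * (m + 1) by ring]
      generalize ∑ k ∈ Finset.Icc 1 m, (-1 : ℚ) ^ k / (k : ℚ) = x
      generalize (∑ k ∈ Finset.Icc 1 m, if 3 ∣ k + p then (-1 : ℚ) ^ k / (k : ℚ) else 0) = y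
      obtain he | he := neg_one_pow_eq_or ℚ m <;> rw [he] <;> split_ifs <;> field_simp <;> ring

theorem sum_trinomialCoeff_even (hp3 : 3 < p) (m : ℕ) (hm : 2 * m ≤ p - 1) :
    (p : ℤ) ∣ (-1) ^ m * (∑ k ∈ Finset.range p, trinomialCoeff k (2 * m : ℕ))
        - (-1) ^ ((p - 1) / 2) ∧
    RatModEq p
      ((((-1) ^ m * (∑ k ∈ Finset.range p, trinomialCoeff k (2 * m : ℕ))
        - (-1) ^ ((p - 1) / 2) : ℤ) : ℚ) / p)
      (3 * (legendreSym p (-2) : ℚ) *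
            ((lucasS (((p : ℤ) - legendreSym p 3) / 2).toNat : ℚ) / (p : ℚ))
          - 2 * ∑ j ∈ Finset.range m, (-1 : ℚ) ^ j / (2 * (j : ℚ) + 1)
          + 3 * ∑ j ∈ (Finset.range m).filter
              (fun j : ℕ => ¬ (3 : ℤ) ∣ (p : ℤ) - 2 * (j : ℤ) - 1),
              (-1 : ℚ) ^ j / (2 * (j : ℚ) + 1)) := by
  induction m with
  | zero =>
    obtain ⟨h, hh⟩ := hp.out.odd_of_ne_two (by omega)
    have h1 := (twistedChooseSum_modEq hp3 hh).1
    have h2 := sum_central_trinomialCoeff_modEq hp3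
    have h3 := h2.sub_right ((-1) ^ ((p - 1) / 2))
    rw [add_sub_cancel_left] at h3
    have hdvd : (p : ℤ) ∣ 3 * legendreSym p (-2) *
      lucasS (((p : ℤ) - legendreSym p 3) / 2).toNat := dvd_mul_of_dvd_right h1 _
    have h4 := (h3.of_dvd (dvd_pow_self (p : ℤ) two_ne_zero)).trans
      (Int.modEq_zero_iff_dvd.mpr hdvd)
    have h5 := Int.modEq_zero_iff_dvd.mp h4
    refine ⟨by simpa using h5, ?_⟩
    convert! ratModEq_div_of_modEq h5 hdvd h3 using 1
    · simp
    · simp [mul_div_assoc]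
  | succ m ih =>
    obtain ⟨ih1, ih2⟩ := ih (by omega)
    have hstep : (-1) ^ (m + 1) * (∑ k ∈ Finset.range p, trinomialCoeff k (2 * (m + 1) : ℕ))
        - (-1) ^ ((p - 1) / 2) =
        (-1) ^ m * (∑ k ∈ Finset.range p, trinomialCoeff k (2 * m : ℕ)) - (-1) ^ ((p - 1) / 2)
          - (-1) ^ m * trinomialCoeff p (2 * m + 1 : ℕ) := by
      rw [show 2 * (m + 1) = 2 * m + 2 by ring, sum_range_trinomialCoeff_add_two]
      ring
    rw [hstep]
    refine ⟨dvd_sub ih1 (dvd_mul_of_dvd_right (prime_dvd_trinomialCoeff (by omega) (by omega)) _),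
      ?_⟩
    have h := ih2.sub ((trinomialCoeff_ratModEq (p := p) (k := 2 * m + 1)
      (by omega) (by omega)).neg_one_pow_mul m)
    convert! h using 1
    · push_cast; ring
    · rw [Finset.sum_filter, Finset.sum_filter, Finset.sum_range_succ, Finset.sum_range_succ,
        cubeTrace]
      -- Here the trace is written as `2 - 3 * [3 ∤ p - 2 * m - 1]`.
      have hiff : 3 ∣ (p : ℤ) - (2 * m + 1 : ℕ) ↔ 3 ∣ (p : ℤ) - 2 * m - 1 := by omega
      simp only [hiff]
      split_ifs
      · push_cast; ring
      · push_cast; ring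

end Prime

theorem theorem1p1 (p : ℕ) [Fact p.Prime] (hp : 3 < p) (d : ℕ) (hd : d ≤ p - 1) :
    (Odd d →
      (p : ℤ) ∣ ∑ k ∈ Finset.range p, trinomialCoeff k d ∧
      RatModEq p
        (1 / (p : ℚ) * ((∑ k ∈ Finset.range p, trinomialCoeff k d : ℤ) : ℚ))
        ((-1 : ℚ) ^ ((d + 1) / 2) / 2 *
          (∑ k ∈ Finset.Icc 1 ((d - 1) / 2), (-1 : ℚ) ^ k / (k : ℚ)
            - 3 * ∑ k ∈ Finset.Icc 1 ((d - 1) / 2) with 3 ∣ k + p, (-1 : ℚ) ^ k / (k : ℚ)))) ∧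
    (Even d →
      (p : ℤ) ∣ (-1) ^ (d / 2) * (∑ k ∈ Finset.range p, trinomialCoeff k d)
        - (-1) ^ ((p - 1) / 2) ∧
      (p : ℤ) ∣ lucasS (((p : ℤ) - legendreSym p 3) / 2).toNat ∧
      RatModEq p
        (1 / (p : ℚ) *
          ((-1 : ℚ) ^ (d / 2) * ((∑ k ∈ Finset.range p, trinomialCoeff k d : ℤ) : ℚ)
            - (-1 : ℚ) ^ ((p - 1) / 2)))
        (3 * (legendreSym p (-2) : ℚ) *
            ((lucasS (((p : ℤ) - legendreSym p 3) / 2).toNat : ℚ) / (p : ℚ))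
          - 2 * ∑ j ∈ Finset.range (d / 2), (-1 : ℚ) ^ j / (2 * (j : ℚ) + 1)
          + 3 * ∑ j ∈ (Finset.range (d / 2)).filter
              (fun j : ℕ => ¬ (3 : ℤ) ∣ (p : ℤ) - 2 * (j : ℤ) - 1),
              (-1 : ℚ) ^ j / (2 * (j : ℚ) + 1))) := by
  constructor
  · rintro ⟨m, rfl⟩
    have h := sum_trinomialCoeff_odd hp m hd
    rw [show (2 * m + 1 + 1) / 2 = m + 1 by omega, show (2 * m + 1 - 1) / 2 = m by omega,
      one_div_mul_eq_div]
    exact h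
  · intro he
    obtain ⟨m, rfl⟩ := he.two_dvd
    obtain ⟨h, hh⟩ := (Fact.out : p.Prime).odd_of_ne_two (by omega)
    have h1 := sum_trinomialCoeff_even hp m hd
    rw [show 2 * m / 2 = m by omega, one_div_mul_eq_div]
    refine ⟨h1.1, (twistedChooseSum_modEq hp hh).1, ?_⟩
    have h2 := h1.2
    push_cast at h2 ⊢
    exact h2
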